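/- For a group $H$ and a function $\phi\colon H\to\mathbb{R}$ put $D(\phi)=\sup_{h_1,h_2\in H}|\phi(h_1h_2)-\phi(h_1)-\phi(h_2)|$. A homogeneous quasimorphism on $H$ is a function $\phi$ with $D(\phi)<\infty$ and $\phi(h^k)=k\,\phi(h)$ for all $h\in H$, $k\in\mathbb{Z}$; these form a real vector space $\mathrm{Q}(H)$. Let $G$ be a group, $N=[G,G]$ its commutator subgroup, $i\colon N\hookrightarrow G$ the inclusion, $\Gamma=G/N$ (written additively) and $p\colon G\to\Gamma$ the quotient map; write $[g_1,g_2]=g_1g_2g_1^{-1}g_2^{-1}$. Let $\mathrm{Q}(N)^G$ be the space of all $\mu\in \mathrm{Q}(N)$ with $\mu(gxg^{-1})=\mu(x)$ for all $g\in G$, $x\in N$, let $i^*\mathrm{Q}(G)\subseteq \mathrm{Q}(N)^G$ be the subspace of restrictions $\phi|_N$ with $\phi\in \mathrm{Q}(G)$ (the extendable quasimorphisms), let $\mathrm{V}(G,N)=\mathrm{Q}(N)^G/i^*\mathrm{Q}(G)$, and let $\mathcal{A}(\Gamma)$ be the real vector space of alternating $\mathbb{Z}$-bilinear forms $\Gamma\times\Gamma\to\mathbb{R}$.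 Then the following hold. 1. For every $\mu\in \mathrm{Q}(N)^G$ there is a unique $\mathfrak{b}_\mu\in\mathcal{A}(\Gamma)$ such that for all $g_1,g_2\in G$ $$|\mu([g_1,g_2])-\mathfrak{b}_\mu(p(g_1),p(g_2))|\le D(\mu).$$ 2. (Limit formula) For all $\mu\in \mathrm{Q}(N)^G$ and $g_1,g_2\in G$, $$\lim_{k\to\infty}\frac{\mu([g_1^k,g_2])}{k}=\mathfrak{b}_\mu(p(g_1),p(g_2))=\lim_{l\to\infty}\frac{\mu([g_1,g_2^l])}{l}.$$ More generally, if $\gamma\in\Gamma$ and $(s_k)_{k\ge 1}$ is a sequence in $G$ with $p(s_k)=k\gamma$ for all $k\ge 1$, then for every $g\in G$ $$\lim_{k\to\infty}\frac{\mu([s_k,g])}{k}=\mathfrak{b}_\mu(\gamma,p(g)),\qquad \lim_{k\to\infty}\frac{\mu([g,s_k])}{k}=\mathfrak{b}_\mu(p(g),\gamma).$$ 3. The map $\mathcal{B}\colon \mathrm{Q}(N)^G\to\mathcal{A}(\Gamma)$, $\mu\mapsto\mathfrak{b}_\mu$, is $\mathbb{R}$-linear and $\ker\mathcal{B}=i^*\mathrm{Q}(G)$.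 4. Consequently $\mathcal{B}$ induces an injective $\mathbb{R}$-linear map $\mathrm{V}(G,N)\hookrightarrow\mathcal{A}(\Gamma)$, $[\mu]\mapsto\mathfrak{b}_\mu$. -/

import Mathlib

noncomputable section

namespace InvQM

/-- The defect `D(φ) = sup_{g₁,g₂} |φ(g₁g₂) - φ(g₁) - φ(g₂)|`
(meaningful when the supremum is finite, i.e. when `φ` is a quasimorphism). -/
def defect {G : Type*} [Group G] (φ : G → ℝ) : ℝ :=
  ⨆ x : G × G, |φ (x.1 * x.2) - φ x.1 - φ x.2|

/-- `φ` is a quasimorphism: the supremum defining the defect is finite. -/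
def IsQuasimorphism {G : Type*} [Group G] (φ : G → ℝ) : Prop :=
  BddAbove (Set.range fun x : G × G => |φ (x.1 * x.2) - φ x.1 - φ x.2|)

/-- `φ(g^k) = k φ(g)` for all integers `k`. -/
def IsHomogeneous {G : Type*} [Group G] (φ : G → ℝ) : Prop :=
  ∀ (g : G) (k : ℤ), φ (g ^ k) = k * φ g

theorem isQuasimorphism_iff {G : Type*} [Group G] {φ : G → ℝ} :
    IsQuasimorphism φ ↔ ∃ C, ∀ g h, |φ (g * h) - φ g - φ h| ≤ C := by
  constructor
  · rintro ⟨C, hC⟩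
    exact ⟨C, fun g h => hC ⟨(g, h), rfl⟩⟩
  · rintro ⟨C, hC⟩
    refine ⟨C, ?_⟩
    rintro _ ⟨x, rfl⟩
    exact hC x.1 x.2

/-- `Q(G)`: the real vector space of homogeneous quasimorphisms on `G`. -/
def Q (G : Type*) [Group G] : Submodule ℝ (G → ℝ) where
  carrier := {φ | IsQuasimorphism φ ∧ IsHomogeneous φ}
  zero_mem' := ⟨isQuasimorphism_iff.2 ⟨0, by simp⟩, by intro g k; simp⟩
  add_mem' := by
    rintro φ ψ ⟨hφ, hφ'⟩ ⟨hψ, hψ'⟩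
    obtain ⟨C, hC⟩ := isQuasimorphism_iff.1 hφ
    obtain ⟨C', hC'⟩ := isQuasimorphism_iff.1 hψ
    refine ⟨isQuasimorphism_iff.2 ⟨C + C', fun g h => ?_⟩, fun g k => ?_⟩
    · have e : (φ + ψ) (g * h) - (φ + ψ) g - (φ + ψ) h
          = (φ (g * h) - φ g - φ h) + (ψ (g * h) - ψ g - ψ h) := by
        simp only [Pi.add_apply]; ring
      rw [e]
      exact (abs_add_le _ _).trans (add_le_add (hC g h) (hC' g h))
    · simp only [Pi.add_apply, hφ' g k, hψ' g k]; ring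
  smul_mem' := by
    rintro c φ ⟨hφ, hφ'⟩
    obtain ⟨C, hC⟩ := isQuasimorphism_iff.1 hφ
    refine ⟨isQuasimorphism_iff.2 ⟨|c| * C, fun g h => ?_⟩, fun g k => ?_⟩
    · have e : (c • φ) (g * h) - (c • φ) g - (c • φ) h = c * (φ (g * h) - φ g - φ h) := by
        simp only [Pi.smul_apply, smul_eq_mul]; ring
      rw [e, abs_mul]
      exact mul_le_mul_of_nonneg_left (hC g h) (abs_nonneg c)
    · simp only [Pi.smul_apply, smul_eq_mul, hφ' g k]; ring

/-- Homogeneous quasimorphisms are invariant under conjugation. -/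
theorem Q_conj {G : Type*} [Group G] {φ : G → ℝ} (hφ : φ ∈ Q G) (g x : G) :
    φ (g * x * g⁻¹) = φ x := by
  obtain ⟨hq, hh⟩ := hφ
  obtain ⟨C, hC⟩ := isQuasimorphism_iff.1 hq
  have key : ∀ k : ℕ, (k : ℝ) * |φ (g * x * g⁻¹) - φ x| ≤ 2 * C + |φ g + φ g⁻¹| := by
    intro k
    have h1 := hh (g * x * g⁻¹) k
    have h2 := hh x k
    rw [zpow_natCast, conj_pow] at h1
    rw [zpow_natCast] at h2
    have a := hC (g * x ^ k) g⁻¹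
    have b := hC g (x ^ k)
    push_cast at h1 h2
    rw [h1] at a
    rw [h2] at b
    rw [← Nat.abs_cast k, ← abs_mul, mul_sub]
    have e : (k : ℝ) * φ (g * x * g⁻¹) - k * φ x
        = (k * φ (g * x * g⁻¹) - φ (g * x ^ k) - φ g⁻¹)
          + (φ (g * x ^ k) - φ g - k * φ x) + (φ g + φ g⁻¹) := by ring
    rw [e]
    refine (abs_add_three _ _ _).trans ?_
    linarith
  by_contra hne
  have hpos : 0 < |φ (g * x * g⁻¹) - φ x| := abs_pos.2 (sub_ne_zero.2 hne)
  obtain ⟨k, hk⟩ := exists_nat_gt ((2 * C + |φ g + φ g⁻¹|) / |φ (g * x * g⁻¹) - φ x|)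
  rw [div_lt_iff₀ hpos] at hk
  exact absurd (key k) (not_le.2 hk)

/-- `Q(N)^G`: the homogeneous quasimorphisms `μ` on the normal subgroup `N` that satisfy
`μ(g x g⁻¹) = μ(x)` for all `g ∈ G` and `x ∈ N`. -/
def QInv {G : Type*} [Group G] (N : Subgroup G) [hN : N.Normal] : Submodule ℝ (N → ℝ) where
  carrier := {μ | μ ∈ Q N ∧
    ∀ (g : G) (x : N), μ ⟨g * (x : G) * g⁻¹, hN.conj_mem x x.2 g⟩ = μ x}
  zero_mem' := ⟨(Q N).zero_mem, by intro g x; rfl⟩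
  add_mem' := by
    rintro μ ν ⟨hμ, hμ'⟩ ⟨hν, hν'⟩
    exact ⟨(Q N).add_mem hμ hν, fun g x => by simp only [Pi.add_apply, hμ' g x, hν' g x]⟩
  smul_mem' := by
    rintro c μ ⟨hμ, hμ'⟩
    exact ⟨(Q N).smul_mem c hμ, fun g x => by simp only [Pi.smul_apply, hμ' g x]⟩

/-- `i^* : Q(G) → Q(N)^G`, the restriction `φ ↦ φ|_N`. -/
def restrict {G : Type*} [Group G] (N : Subgroup G) [N.Normal] : Q G →ₗ[ℝ] QInv N where
  toFun φ := ⟨fun x => φ.1 (x : G), by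
    refine ⟨⟨?_, ?_⟩, ?_⟩
    · obtain ⟨C, hC⟩ := isQuasimorphism_iff.1 φ.2.1
      exact isQuasimorphism_iff.2 ⟨C, fun g h => hC g h⟩
    · intro g k
      exact φ.2.2 g k
    · intro g x
      exact Q_conj φ.2 g x⟩
  map_add' _ _ := rfl
  map_smul' _ _ := rfl

/-- `i^* Q(G)`: the invariant homogeneous quasimorphisms on `N` that extend to
homogeneous quasimorphisms on `G`. -/
def extendable {G : Type*} [Group G] (N : Subgroup G) [N.Normal] : Submodule ℝ (QInv N) :=
  LinearMap.range (restrict N)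

/-- `V(G,N) = Q(N)^G / i^* Q(G)`. -/
abbrev V {G : Type*} [Group G] (N : Subgroup G) [N.Normal] : Type _ :=
  QInv N ⧸ extendable N

/-- `A(Γ)`: the real vector space of real-valued alternating `ℤ`-bilinear forms on an
(additively written) abelian group `Γ`. -/
def A (Γ : Type*) [AddCommGroup Γ] : Submodule ℝ (Γ →ₗ[ℤ] Γ →ₗ[ℤ] ℝ) where
  carrier := {b | b.IsAlt}
  zero_mem' := by intro x; rfl
  add_mem' := by
    intro b c hb hc x
    simp [hb.self_eq_zero x, hc.self_eq_zero x]
  smul_mem' := by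
    intro r b hb x
    simp [hb.self_eq_zero x]

/-- `Γ = G/[G,G]`, written additively. -/
abbrev Ab (G : Type*) [Group G] : Type _ := Additive (Abelianization G)

/-- The quotient map `p : G → Γ`. -/
def p {G : Type*} [Group G] (g : G) : Ab G := Additive.ofMul (Abelianization.of g)

/-- The commutator `[g₁,g₂] = g₁ g₂ g₁⁻¹ g₂⁻¹` as an element of `N = [G,G]`. -/
def comm {G : Type*} [Group G] (g₁ g₂ : G) : commutator G :=
  ⟨g₁ * g₂ * g₁⁻¹ * g₂⁻¹,
    Subgroup.commutator_mem_commutator (Subgroup.mem_top g₁) (Subgroup.mem_top g₂)⟩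

end InvQM

end

/-! Since `[gh,k] = g[h,k]g⁻¹ · [g,k]` and `μ` is `G`-invariant, the function `g ↦ μ([g,k])` is a
quasimorphism on `G` of defect at most `D(μ)`. Its homogenization stays within `D(μ)` of it. Uniform
error bounds make this homogenization additive in `k` and antisymmetric, hence biadditive, so it
descends to an alternating form on the abelianization. Bounded distance between bilinear forms
forces equality; this gives uniqueness and linearity. The limit formula is the approximation divided
by `k`.

A homogeneous quasimorphism on `G` is bounded on commutators, so restrictions have zero form.
Conversely, if the form of `μ` vanishes, then `|μ| ≤ D(μ)` on commutators of `G`, and `μ` is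
extended by Zorn's lemma, one generator at a time. The danger is growth of the defect along the way.
It is excluded by Bavard's theorem (`defect_le_of_abs_commutator_le`): the defect is controlled by
the values on commutators, and these all lie in `[G,G]`, where the extension is still `μ`. -/

noncomputable section

namespace InvQM

open Filter Topology

/-! ### Homogenization and Bavard's bound on the defect. -/

section Quasimorphisms

variable {G : Type*} [Group G]

/-- The defect of a quasimorphism bounds each of its additivity errors. -/
theorem abs_le_defect {φ : G → ℝ} (hφ : IsQuasimorphism φ) (g h : G) :
    |φ (g * h) - φ g - φ h| ≤ defect φ :=
  le_ciSup hφ (g, h)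

theorem IsHomogeneous.map_pow {φ : G → ℝ} (hφ : IsHomogeneous φ) (g : G) (n : ℕ) :
    φ (g ^ n) = n * φ g := by
  simpa using hφ g n

theorem IsHomogeneous.map_inv {φ : G → ℝ} (hφ : IsHomogeneous φ) (g : G) :
    φ g⁻¹ = -φ g := by
  simpa using hφ g (-1)

/-- A real number whose natural multiples are uniformly bounded vanishes. -/
theorem eq_zero_of_forall_nat_mul_abs_le {x C : ℝ} (h : ∀ n : ℕ, n * |x| ≤ C) : x = 0 := by
  by_contra hx
  have hpos : 0 < |x| := abs_pos.2 hx
  obtain ⟨n, hn⟩ := exists_nat_gt (C / |x|)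
  rw [div_lt_iff₀ hpos] at hn
  exact absurd (h n) (not_le.2 hn)

/-- Homogeneous functions at bounded distance agree. -/
theorem eq_of_homogeneous_of_abs_sub_le {φ ψ : G → ℝ}
    (hφ : IsHomogeneous φ) (hψ : IsHomogeneous ψ) {C : ℝ} (h : ∀ g, |φ g - ψ g| ≤ C) : φ = ψ := by
  funext g
  refine sub_eq_zero.1 (eq_zero_of_forall_nat_mul_abs_le (C := C) fun n => ?_)
  have := h (g ^ n)
  rwa [hφ.map_pow, hψ.map_pow, ← mul_sub, abs_mul, Nat.abs_cast] at this

theorem abs_map_pow_succ_sub_le {f : G → ℝ} {C : ℝ}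
    (hf : ∀ g h, |f (g * h) - f g - f h| ≤ C) (g : G) (n : ℕ) :
    |f (g ^ (n + 1)) - (n + 1) * f g| ≤ n * C := by
  induction n with
  | zero => simp
  | succ n ih =>
    have h := hf (g ^ (n + 1)) g
    rw [← pow_succ] at h
    rw [abs_le] at *
    push_cast
    constructor <;> linarith [h.1, h.2, ih.1, ih.2]

theorem tendsto_div_natCast_of_abs_sub_le {u : ℕ → ℝ} {x C : ℝ}
    (h : ∀ n : ℕ, 1 ≤ n → |u n - n * x| ≤ C) :
    Tendsto (fun n : ℕ => u n / n) atTop (𝓝 x) := by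
  rw [tendsto_iff_dist_tendsto_zero]
  refine squeeze_zero' (Eventually.of_forall fun _ => dist_nonneg) ?_
    (tendsto_const_div_atTop_nhds_zero_nat C)
  filter_upwards [eventually_ge_atTop 1] with n hn
  have hn' : (0 : ℝ) < n := by exact_mod_cast hn
  have e : u n / n - x = (u n - n * x) / n := by field_simp
  rw [Real.dist_eq, e, abs_div, Nat.abs_cast]
  exact div_le_div_of_nonneg_right (h n hn) hn'.le

/-- Homogenization of a quasimorphism. -/
theorem exists_homogenization {f : G → ℝ} {C : ℝ} (hf : ∀ g h, |f (g * h) - f g - f h| ≤ C) :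
    ∃ φ : G → ℝ, IsHomogeneous φ ∧ (∀ g, |φ g - f g| ≤ C) ∧
      ∀ g, Tendsto (fun n : ℕ => f (g ^ n) / n) atTop (𝓝 (φ g)) := by
  have hC : 0 ≤ C := (abs_nonneg _).trans (hf 1 1)
  have key : ∀ g, ∃ x, Tendsto (fun n : ℕ => f (g ^ n) / n) atTop (𝓝 x) := by
    intro g
    -- Fekete's lemma gives the limit: adding `C` makes the sequence subadditive and disappears
    -- after division by `n`.
    have hsub : Subadditive fun n : ℕ => f (g ^ n) + C := by
      intro m n
      have := (abs_le.1 (hf (g ^ m) (g ^ n))).2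
      rw [← pow_add] at this
      linarith
    have hbdd : BddBelow (Set.range fun n : ℕ => (f (g ^ n) + C) / n) := by
      refine ⟨-(|f g| + C), ?_⟩
      rintro _ ⟨n, rfl⟩
      rcases n with _ | n
      · simp only [Nat.cast_zero, div_zero]
        linarith [abs_nonneg (f g)]
      · have h1 := (abs_le.1 (abs_map_pow_succ_sub_le hf g n)).1
        have hn : (0 : ℝ) < ((n + 1 : ℕ) : ℝ) := by positivity
        rw [le_div_iff₀ hn]
        push_cast
        nlinarith [neg_abs_le (f g), abs_nonneg (f g), (Nat.cast_nonneg n : (0 : ℝ) ≤ n)]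
    refine ⟨hsub.lim, ?_⟩
    have h := (hsub.tendsto_lim hbdd).sub (tendsto_const_div_atTop_nhds_zero_nat C)
    rw [sub_zero] at h
    refine h.congr fun n => ?_
    rw [← sub_div, add_sub_cancel_right]
  choose φ hφ using key
  have hpow : ∀ g (k : ℕ), φ (g ^ k) = k * φ g := by
    intro g k
    rcases Nat.eq_zero_or_pos k with rfl | hk
    · refine tendsto_nhds_unique (hφ _) ?_
      simpa using tendsto_const_div_atTop_nhds_zero_nat (f 1)
    · have hk' : (k : ℝ) ≠ 0 := by exact_mod_cast hk.ne'
      have h := ((hφ g).comp (tendsto_id.const_mul_atTop' hk)).const_mul (k : ℝ)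
      refine tendsto_nhds_unique (hφ _) (h.congr fun n => ?_)
      simp only [Function.comp_apply, id_eq, pow_mul, Nat.cast_mul]
      rw [mul_div_assoc', mul_div_mul_left _ _ hk']
  have hinv : ∀ g, φ g⁻¹ = -φ g := by
    intro g
    have h0 : Tendsto (fun n : ℕ => (f (g ^ n) + f (g⁻¹ ^ n)) / n) atTop (𝓝 0) := by
      refine tendsto_div_natCast_of_abs_sub_le (C := C + |f 1|) fun n _ => ?_
      have h := hf (g ^ n) (g⁻¹ ^ n)
      rw [inv_pow, mul_inv_cancel, abs_le] at h
      rw [inv_pow, abs_le]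
      constructor <;> linarith [h.1, h.2, neg_abs_le (f 1), le_abs_self (f 1)]
    have h1 := (hφ g).add (hφ g⁻¹)
    simp only [← add_div] at h1
    linarith [tendsto_nhds_unique h0 h1]
  refine ⟨φ, fun g k => ?_, fun g => ?_, hφ⟩
  · obtain ⟨n, rfl | rfl⟩ := k.eq_nat_or_neg
    · simpa using hpow g n
    · rw [zpow_neg, hinv, zpow_natCast, hpow]
      push_cast
      ring
  · have h1 : Tendsto (fun n : ℕ => |f (g ^ n) / n - f g|) atTop (𝓝 |φ g - f g|) :=
      ((hφ g).sub_const _).abs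
    refine le_of_tendsto h1 ?_
    filter_upwards [eventually_ge_atTop 1] with n hn
    obtain ⟨n, rfl⟩ := Nat.exists_eq_add_of_le' hn
    have hn' : (0 : ℝ) < ((n + 1 : ℕ) : ℝ) := by positivity
    have e : f (g ^ (n + 1)) / ((n + 1 : ℕ) : ℝ) - f g
        = (f (g ^ (n + 1)) - (n + 1) * f g) / ((n + 1 : ℕ) : ℝ) := by
      push_cast at hn' ⊢
      field_simp
    rw [e, abs_div, Nat.abs_cast, div_le_iff₀ hn']
    refine (abs_map_pow_succ_sub_le hf g n).trans ?_
    push_cast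
    nlinarith

theorem isQuasimorphism_of_abs_sub_le {φ f : G → ℝ} {C : ℝ}
    (hf : ∀ g h, |f (g * h) - f g - f h| ≤ C) (hφ : ∀ g, |φ g - f g| ≤ C) :
    IsQuasimorphism φ := by
  refine isQuasimorphism_iff.2 ⟨4 * C, fun g h => ?_⟩
  have h1 := abs_le.1 (hf g h)
  have h2 := abs_le.1 (hφ (g * h))
  have h3 := abs_le.1 (hφ g)
  have h4 := abs_le.1 (hφ h)
  rw [abs_le]
  constructor <;> linarith [h1.1, h1.2, h2.1, h2.2, h3.1, h3.2, h4.1, h4.2]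

theorem mul_mul_pow_mul (a b : G) (n : ℕ) : a * (b * a) ^ n * b = (a * b) ^ (n + 1) := by
  induction n with
  | zero => simp
  | succ n ih =>
    rw [pow_succ (a * b), ← ih, pow_succ (b * a)]
    simp only [mul_assoc]

/-- With `x = b(ab)^(k+1)` and `y = ab⁻¹`, the last factor is `yxb`, and `[x,y] · yxb = xyb =
(ba)^(k+2)`. Thus two factors `ba` are unshuffled into `a²` and `b²` at the cost of one commutator.
-/
theorem mul_pow_add_two (a b : G) (k : ℕ) :
    (b * a) ^ (k + 2) = b * (a * b) ^ (k + 1) * (a * b⁻¹) * (b * (a * b) ^ (k + 1))⁻¹ *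
      (a * b⁻¹)⁻¹ * (a ^ 2 * (b * a) ^ k * b ^ 2) := by
  have h : a ^ 2 * (b * a) ^ k * b ^ 2 = a * (a * b) ^ (k + 1) * b := by
    rw [← mul_mul_pow_mul]
    simp only [pow_two, mul_assoc]
  rw [h, ← mul_mul_pow_mul b a (k + 1)]
  group

/-- The defect of a homogeneous quasimorphism is bounded by its supremum over commutators. -/
theorem defect_le_of_abs_commutator_le {φ : G → ℝ} (hφ : φ ∈ Q G) {S : ℝ}
    (hS : ∀ x y, |φ (x * y * x⁻¹ * y⁻¹)| ≤ S) : defect φ ≤ S := by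
  obtain ⟨hq, hh⟩ := id hφ
  have hD := abs_le_defect hq
  set D := defect φ
  -- Each unshuffling costs `S` for the commutator, conjugated to the front by `a ^ m`, and `D` for
  -- splitting it off. One such step handles two factors `ba`, whence the rate `(D + S) / 2` below;
  -- this average gives `D ≤ S`.
  have step : ∀ (a b : G) (k m : ℕ),
      |φ (a ^ m * (b * a) ^ (2 * k) * b ^ m) - φ (a ^ (m + 2 * k) * b ^ (m + 2 * k))|
        ≤ k * (D + S) := by
    intro a b k
    induction k with
    | zero => intro m; simp
    | succ k ih =>
      intro m
      obtain ⟨x, y, hxy⟩ : ∃ x y, (b * a) ^ (2 * (k + 1)) =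
          x * y * x⁻¹ * y⁻¹ * (a ^ 2 * (b * a) ^ (2 * k) * b ^ 2) :=
        ⟨_, _, mul_pow_add_two a b (2 * k)⟩
      have e1 : a ^ m * (b * a) ^ (2 * (k + 1)) * b ^ m =
          (a ^ m * (x * y * x⁻¹ * y⁻¹) * (a ^ m)⁻¹) *
            (a ^ (m + 2) * (b * a) ^ (2 * k) * b ^ (m + 2)) := by
        rw [hxy, pow_add a m 2, add_comm m 2, pow_add b 2 m]
        group
      have h1 := abs_le.1 (hD (a ^ m * (x * y * x⁻¹ * y⁻¹) * (a ^ m)⁻¹)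
        (a ^ (m + 2) * (b * a) ^ (2 * k) * b ^ (m + 2)))
      rw [← e1, Q_conj hφ] at h1
      have h2 := abs_le.1 (hS x y)
      have h3 := abs_le.1 (ih (m + 2))
      rw [show m + 2 + 2 * k = m + 2 * (k + 1) by ring] at h3
      rw [abs_le]
      push_cast
      constructor <;> linarith [h1.1, h1.2, h2.1, h2.2, h3.1, h3.2]
  have half : ∀ a b : G, |φ (b * a) - φ b - φ a| ≤ (D + S) / 2 := by
    intro a b
    have hlim : Tendsto (fun n : ℕ => (D + S) / 2 + D / 2 / n) atTop (𝓝 ((D + S) / 2 + 0)) :=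
      (tendsto_const_div_atTop_nhds_zero_nat (D / 2)).const_add _
    rw [add_zero] at hlim
    refine ge_of_tendsto hlim ?_
    filter_upwards [eventually_ge_atTop 1] with n hn
    have hn' : (0 : ℝ) < n := by exact_mod_cast hn
    have h1 := step a b n 0
    have h2 := hD (a ^ (2 * n)) (b ^ (2 * n))
    simp only [pow_zero, one_mul, mul_one, zero_add] at h1
    rw [hh.map_pow] at h1
    rw [hh.map_pow, hh.map_pow] at h2
    have e : φ (b * a) - φ b - φ a = ((2 * n : ℕ) * φ (b * a) - (2 * n : ℕ) * φ b -
        (2 * n : ℕ) * φ a) / (2 * n) := by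
      push_cast
      field_simp
    rw [e, abs_div, abs_of_pos (by positivity : (0 : ℝ) < 2 * n), div_le_iff₀ (by positivity)]
    have e2 : ((D + S) / 2 + D / 2 / n) * (2 * n) = n * (D + S) + D := by
      field_simp
    rw [e2]
    rw [abs_le] at h1 h2 ⊢
    constructor <;> linarith [h1.1, h1.2, h2.1, h2.2]
  have : D ≤ (D + S) / 2 := ciSup_le fun x => half x.2 x.1
  linarith

end Quasimorphisms

/-! ### Extending from the commutator subgroup to the whole group. -/

section Extension

variable {G : Type*} [Group G]

/-- `φ` restricts to a homogeneous quasimorphism of defect at most `S` on the subgroup `H`,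
and to `μ` on the commutator subgroup, which `H` contains. -/
structure IsPartialExtension (μ : commutator G → ℝ) (S : ℝ) (H : Subgroup G) (φ : G → ℝ) :
    Prop where
  le : commutator G ≤ H
  map_zpow : ∀ x ∈ H, ∀ k : ℤ, φ (x ^ k) = k * φ x
  abs_le : ∀ x ∈ H, ∀ y ∈ H, |φ (x * y) - φ x - φ y| ≤ S
  eq_on : ∀ x : commutator G, φ x = μ x

theorem normal_of_commutator_le {H : Subgroup G} (h : commutator G ≤ H) : H.Normal := by
  refine ⟨fun x hx g => ?_⟩
  have : g * x * g⁻¹ * x⁻¹ ∈ H := h (comm g x).2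
  simpa using H.mul_mem this hx

namespace IsPartialExtension

variable {μ : commutator G → ℝ} {S : ℝ} {H : Subgroup G} {φ : G → ℝ}

theorem map_pow (h : IsPartialExtension μ S H φ) {x : G} (hx : x ∈ H) (n : ℕ) :
    φ (x ^ n) = n * φ x := by
  simpa using h.map_zpow x hx n

/-- Here `g` need not lie in `H`. Since `g xⁿ g⁻¹ = [g, xⁿ] xⁿ`, the two values at `n`-th powers
differ by at most `2S`, and homogeneity removes the error. -/
theorem map_conj (h : IsPartialExtension μ S H φ) (hS : ∀ x y : G, |μ (comm x y)| ≤ S)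
    (g : G) {x : G} (hx : x ∈ H) : φ (g * x * g⁻¹) = φ x := by
  have hn := normal_of_commutator_le h.le
  refine sub_eq_zero.1 (eq_zero_of_forall_nat_mul_abs_le (C := S + S) fun n => ?_)
  rw [← Nat.abs_cast n, ← abs_mul, mul_sub, ← h.map_pow hx, ← h.map_pow (hn.conj_mem x hx g),
    conj_pow]
  have h1 := h.abs_le _ (h.le (comm g (x ^ n)).2) _ (H.pow_mem hx n)
  rw [h.eq_on, show ((comm g (x ^ n) : commutator G) : G) * x ^ n = g * x ^ n * g⁻¹ by
    simp [comm]] at h1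
  have h2 := hS g (x ^ n)
  rw [_root_.abs_le] at h1 h2 ⊢
  constructor <;> linarith [h1.1, h1.2, h2.1, h2.2]

/-- A slope for `t` compatible with the values of `φ` on the powers of `t` lying in `H`. -/
theorem exists_slope (h : IsPartialExtension μ S H φ) (t : G) :
    ∃ c : ℝ, ∀ j : ℤ, t ^ j ∈ H → φ (t ^ j) = j * c := by
  by_cases ht : ∃ m : ℤ, m ≠ 0 ∧ t ^ m ∈ H
  · obtain ⟨m, hm, htm⟩ := ht
    refine ⟨φ (t ^ m) / m, fun j hj => ?_⟩
    have hm' : (m : ℝ) ≠ 0 := by exact_mod_cast hm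
    have e : (m : ℝ) * φ (t ^ j) = j * φ (t ^ m) := by
      rw [← h.map_zpow _ hj, ← h.map_zpow _ htm, ← zpow_mul, ← zpow_mul, mul_comm]
    field_simp
    linarith
  · push Not at ht
    -- No nonzero power of `t` lies in `H`, so the slope is unconstrained and `0` serves.
    refine ⟨0, fun j hj => ?_⟩
    have hj0 : j = 0 := by
      by_contra h0
      exact ht j h0 hj
    subst hj0
    simpa using h.map_zpow 1 H.one_mem 0

/-- A partial extension extends further to the subgroup generated by its domain and `t`. -/
theorem exists_extension (h : IsPartialExtension μ S H φ) (hS : ∀ x y : G, |μ (comm x y)| ≤ S)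
    (t : G) : ∃ (K : Subgroup G) (ψ : G → ℝ), IsPartialExtension μ S K ψ ∧ t ∈ K ∧ H ≤ K ∧
      ∀ x ∈ H, ψ x = φ x := by
  classical
  have hn := normal_of_commutator_le h.le
  let K : Subgroup G := H ⊔ Subgroup.zpowers t
  have hHK : H ≤ K := le_sup_left
  have htK : t ∈ K := (le_sup_right : _ ≤ K) (Subgroup.mem_zpowers t)
  obtain ⟨c, hc⟩ := h.exists_slope t
  have hex : ∀ x : K, ∃ k : ℤ, (x : G) * t ^ (-k) ∈ H := by
    intro x
    obtain ⟨y, hy, z, ⟨k, rfl⟩, e⟩ := Subgroup.mem_sup_of_normal_left.1 x.2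
    refine ⟨k, ?_⟩
    rw [← e]
    simpa using hy
  choose e he using hex
  -- The exponent `e x` is an arbitrary choice; by `hf`, another admissible one changes the value by
  -- at most `S`, since the compatible slope `c` accounts for the power of `t` moved into `H`.
  let f : K → ℝ := fun x => φ (x * t ^ (-e x)) + e x * c
  have hf : ∀ (x : K) (k : ℤ), (x : G) * t ^ (-k) ∈ H →
      |f x - φ (x * t ^ (-k)) - k * c| ≤ S := by
    intro x k hk
    have e1 : (x : G) * t ^ (-k) = x * t ^ (-e x) * t ^ (e x - k) := by
      rw [mul_assoc, ← zpow_add]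
      congr 2
      ring
    have hj : t ^ (e x - k) ∈ H := (H.mul_mem_cancel_left (he x)).1 (e1 ▸ hk)
    have h1 := h.abs_le _ (he x) _ hj
    rw [← e1, hc _ hj] at h1
    push_cast at h1
    rw [_root_.abs_le] at h1 ⊢
    simp only [f]
    constructor <;> linarith [h1.1, h1.2]
  -- One `S` comes from the product in `H`, the other from replacing `e (x * y)` by `e x + e y`.
  have hfq : ∀ x y : K, |f (x * y) - f x - f y| ≤ S + S := by
    intro x y
    have hy' : t ^ e x * (y * t ^ (-e y)) * (t ^ e x)⁻¹ ∈ H := hn.conj_mem _ (he y) _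
    have e1 : ((x * y : K) : G) * t ^ (-(e x + e y)) =
        (x * t ^ (-e x)) * (t ^ e x * (y * t ^ (-e y)) * (t ^ e x)⁻¹) := by
      push_cast
      group
    have h1 := hf (x * y) (e x + e y) (e1 ▸ H.mul_mem (he x) hy')
    have h2 := h.abs_le _ (he x) _ hy'
    rw [h.map_conj hS _ (he y), ← e1] at h2
    push_cast at h1 h2
    rw [_root_.abs_le] at h1 h2 ⊢
    simp only [f] at h1 ⊢
    push_cast at h1 ⊢
    constructor <;> linarith [h1.1, h1.2, h2.1, h2.2]
  obtain ⟨ψ, hψ, hψf, -⟩ := exists_homogenization hfq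
  have hψQ : ψ ∈ Q K := ⟨isQuasimorphism_of_abs_sub_le hfq hψf, hψ⟩
  have hψH : ∀ (x : G) (hx : x ∈ H), ψ ⟨x, hHK hx⟩ = φ x := by
    have hres := eq_of_homogeneous_of_abs_sub_le (G := H)
      (φ := fun x => ψ ⟨x, hHK x.2⟩) (ψ := fun x => φ x) (fun x k => hψ ⟨x, hHK x.2⟩ k)
      (fun x k => h.map_zpow x x.2 k) (C := S + S + S) fun x => by
        have h1 := hψf ⟨x, hHK x.2⟩
        have h2 := hf ⟨x, hHK x.2⟩ 0 (by simp)
        simp only [neg_zero, zpow_zero, mul_one, Int.cast_zero, zero_mul, sub_zero] at h2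
        rw [_root_.abs_le] at h1 h2 ⊢
        constructor <;> linarith [h1.1, h1.2, h2.1, h2.2]
    exact fun x hx => congrFun hres ⟨x, hx⟩
  -- Bavard's bound brings the defect back down to `S`, so that the extension can be iterated.
  have hdef : defect ψ ≤ S := by
    refine defect_le_of_abs_commutator_le hψQ fun x y => ?_
    have h1 : ψ (x * y * x⁻¹ * y⁻¹) = μ (comm (x : G) y) :=
      (hψH _ (h.le (comm (x : G) y).2)).trans (h.eq_on _)
    rw [h1]
    exact hS _ _
  have hext : ∀ (x : G) (hx : x ∈ K),
      (if hx : x ∈ K then ψ ⟨x, hx⟩ else 0) = ψ ⟨x, hx⟩ := fun x hx => dif_pos hx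
  refine ⟨K, fun x => if hx : x ∈ K then ψ ⟨x, hx⟩ else 0, ⟨h.le.trans hHK, ?_, ?_, ?_⟩, htK,
    hHK, ?_⟩
  · intro x hx k
    rw [hext _ hx, hext _ (K.zpow_mem hx k)]
    exact hψ ⟨x, hx⟩ k
  · intro x hx y hy
    rw [hext _ hx, hext _ hy, hext _ (K.mul_mem hx hy)]
    exact (abs_le_defect hψQ.1 ⟨x, hx⟩ ⟨y, hy⟩).trans hdef
  · intro x
    rw [hext _ (hHK (h.le x.2)), hψH _ (h.le x.2), h.eq_on]
  · intro x hx
    exact (hext _ (hHK hx)).trans (hψH _ hx)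

end IsPartialExtension

/-- An invariant homogeneous quasimorphism on the commutator subgroup whose values on commutators
are bounded by its defect extends to a homogeneous quasimorphism on the whole group. -/
theorem mem_extendable_of_abs_comm_le (μ : QInv (commutator G))
    (hS : ∀ x y : G, |μ.1 (comm x y)| ≤ defect μ.1) : μ ∈ extendable (commutator G) := by
  classical
  let T := {a : Subgroup G × (G → ℝ) // IsPartialExtension μ.1 (defect μ.1) a.1 a.2}
  -- Only a preorder: values outside the subgroup are ignored.
  let r : T → T → Prop := fun a b => a.1.1 ≤ b.1.1 ∧ ∀ x ∈ a.1.1, b.1.2 x = a.1.2 x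
  have hbase : IsPartialExtension μ.1 (defect μ.1) (commutator G)
      (fun x => if hx : x ∈ commutator G then μ.1 ⟨x, hx⟩ else 0) := by
    refine ⟨le_rfl, fun x hx k => ?_, fun x hx y hy => ?_, fun x => dif_pos x.2⟩
    · rw [dif_pos hx, dif_pos ((commutator G).zpow_mem hx k)]
      exact μ.2.1.2 ⟨x, hx⟩ k
    · rw [dif_pos hx, dif_pos hy, dif_pos ((commutator G).mul_mem hx hy)]
      exact abs_le_defect μ.2.1.1 ⟨x, hx⟩ ⟨y, hy⟩
  have htrans : ∀ {a b c : T}, r a b → r b c → r a c := fun {a b c} hab hbc =>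
    ⟨hab.1.trans hbc.1, fun x hx => (hbc.2 x (hab.1 hx)).trans (hab.2 x hx)⟩
  have hrefl : ∀ a : T, r a a := fun a => ⟨le_rfl, fun _ _ => rfl⟩
  obtain ⟨m, hm⟩ : ∃ m : T, ∀ a, r m a → r a m := by
    refine exists_maximal_of_chains_bounded (fun s hs => ?_) htrans
    rcases s.eq_empty_or_nonempty with rfl | ⟨a₀, ha₀⟩
    · exact ⟨⟨(_, _), hbase⟩, by simp⟩
    have htot : ∀ a ∈ s, ∀ b ∈ s, ∃ d ∈ s, r a d ∧ r b d := by
      intro a ha b hb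
      by_cases hab : a = b
      · exact ⟨a, ha, hrefl a, hab ▸ hrefl a⟩
      · rcases hs ha hb hab with h | h
        · exact ⟨b, hb, h, hrefl b⟩
        · exact ⟨a, ha, hrefl a, h⟩
    let K : Subgroup G :=
      { carrier := {x | ∃ a ∈ s, x ∈ a.1.1}
        one_mem' := ⟨a₀, ha₀, a₀.1.1.one_mem⟩
        mul_mem' := by
          rintro x y ⟨a, ha, hx⟩ ⟨b, hb, hy⟩
          obtain ⟨d, hd, had, hbd⟩ := htot a ha b hb
          exact ⟨d, hd, d.1.1.mul_mem (had.1 hx) (hbd.1 hy)⟩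
        inv_mem' := by
          rintro x ⟨a, ha, hx⟩
          exact ⟨a, ha, a.1.1.inv_mem hx⟩ }
    -- Any two members of the chain agree where both are defined, so the choice is immaterial. The
    -- common bound on the defect passes to the union.
    let ψ : G → ℝ := fun x => if h : ∃ a ∈ s, x ∈ a.1.1 then h.choose.1.2 x else 0
    have hψ : ∀ a ∈ s, ∀ x ∈ a.1.1, ψ x = a.1.2 x := by
      intro a ha x hx
      have h : ∃ a ∈ s, x ∈ a.1.1 := ⟨a, ha, hx⟩
      obtain ⟨d, -, h1, h2⟩ := htot a ha h.choose h.choose_spec.1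
      simp only [ψ, dif_pos h]
      rw [← h1.2 x hx, ← h2.2 x h.choose_spec.2]
    refine ⟨⟨(K, ψ), ⟨?_, ?_, ?_, ?_⟩⟩, fun a ha => ⟨fun x hx => ⟨a, ha, hx⟩, hψ a ha⟩⟩
    · exact fun x hx => ⟨a₀, ha₀, a₀.2.le hx⟩
    · rintro x ⟨a, ha, hx⟩ k
      change ψ (x ^ k) = k * ψ x
      rw [hψ a ha _ hx, hψ a ha _ (a.1.1.zpow_mem hx k)]
      exact a.2.map_zpow x hx k
    · rintro x ⟨a, ha, hx⟩ y ⟨b, hb, hy⟩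
      obtain ⟨d, hd, had, hbd⟩ := htot a ha b hb
      have hx' := had.1 hx
      have hy' := hbd.1 hy
      change |ψ (x * y) - ψ x - ψ y| ≤ _
      rw [hψ d hd _ hx', hψ d hd _ hy', hψ d hd _ (d.1.1.mul_mem hx' hy')]
      exact d.2.abs_le x hx' y hy'
    · intro x
      exact (hψ a₀ ha₀ _ (a₀.2.le x.2)).trans (a₀.2.eq_on x)
  have htop : ∀ t : G, t ∈ m.1.1 := by
    intro t
    obtain ⟨K, ψ, hKψ, ht, hle, heq⟩ := m.2.exists_extension hS t
    exact (hm ⟨(K, ψ), hKψ⟩ ⟨hle, heq⟩).1 ht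
  refine ⟨⟨m.1.2, isQuasimorphism_iff.2 ⟨defect μ.1, fun x y => ?_⟩, fun x k => ?_⟩, ?_⟩
  · exact m.2.abs_le x (htop x) y (htop y)
  · exact m.2.map_zpow x (htop x) k
  · exact Subtype.ext (funext fun x => m.2.eq_on x)

end Extension

/-! ### The alternating form, its kernel and the limit formula. -/

section BilinearForm

variable {G : Type*} [Group G]

theorem p_surjective : Function.Surjective (p : G → Ab G) := by
  intro γ
  obtain ⟨g, hg⟩ := QuotientGroup.mk_surjective (Additive.toMul γ)
  exact ⟨g, congrArg Additive.ofMul hg⟩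

theorem p_pow (g : G) (n : ℕ) : p (g ^ n) = n • p g := by
  simp [p]

/-- Bilinear forms on the abelianization at bounded distance agree. -/
theorem bilinear_eq_of_abs_sub_le {b b' : A (Ab G)} {C : ℝ}
    (h : ∀ g₁ g₂ : G, |b.1 (p g₁) (p g₂) - b'.1 (p g₁) (p g₂)| ≤ C) : b = b' := by
  refine Subtype.ext (LinearMap.ext₂ fun γ₁ γ₂ => ?_)
  obtain ⟨g₁, rfl⟩ := p_surjective γ₁
  obtain ⟨g₂, rfl⟩ := p_surjective γ₂
  refine sub_eq_zero.1 (eq_zero_of_forall_nat_mul_abs_le (C := C) fun n => ?_)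
  have := h g₁ (g₂ ^ n)
  rwa [p_pow, map_nsmul, map_nsmul, ← smul_sub, nsmul_eq_mul, abs_mul, Nat.abs_cast] at this

theorem abs_comm_mul_left_le (μ : QInv (commutator G)) (g h k : G) :
    |μ.1 (comm (g * h) k) - μ.1 (comm g k) - μ.1 (comm h k)| ≤ defect μ.1 := by
  have e : comm (g * h) k = ⟨g * (comm h k : G) * g⁻¹,
      (inferInstance : (commutator G).Normal).conj_mem _ (comm h k).2 g⟩ * comm g k := by
    refine Subtype.ext ?_
    simp only [comm, Subgroup.coe_mul]
    group
  have h1 := abs_le_defect μ.2.1.1 ⟨g * (comm h k : G) * g⁻¹,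
    (inferInstance : (commutator G).Normal).conj_mem _ (comm h k).2 g⟩ (comm g k)
  rw [← e, μ.2.2 g (comm h k)] at h1
  rwa [sub_right_comm]

theorem comm_inv (g h : G) : (comm g h)⁻¹ = comm h g := by
  refine Subtype.ext ?_
  simp only [comm, Subgroup.coe_inv]
  group

theorem map_comm_swap (μ : QInv (commutator G)) (g h : G) :
    μ.1 (comm h g) = -μ.1 (comm g h) := by
  rw [← comm_inv, IsHomogeneous.map_inv μ.2.1.2]

theorem abs_comm_mul_right_le (μ : QInv (commutator G)) (g h k : G) :
    |μ.1 (comm g (h * k)) - μ.1 (comm g h) - μ.1 (comm g k)| ≤ defect μ.1 := by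
  have h1 := abs_comm_mul_left_le μ h k g
  rw [map_comm_swap μ g (h * k), map_comm_swap μ g h, map_comm_swap μ g k] at h1
  rw [← abs_neg]
  convert h1 using 2
  ring

theorem exists_additive_approximation (μ : QInv (commutator G)) :
    ∃ b : G → G → ℝ, (∀ g h, |μ.1 (comm g h) - b g h| ≤ defect μ.1) ∧
      (∀ g h k, b (g * h) k = b g k + b h k) ∧ (∀ g h k, b g (h * k) = b g h + b g k) ∧
      ∀ g, b g g = 0 := by
  have key := fun k : G => exists_homogenization
    (f := fun g => μ.1 (comm g k)) fun g h => abs_comm_mul_left_le μ g h k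
  choose β hβ hβD hβlim using key
  have happ : ∀ g h, |μ.1 (comm g h) - β h g| ≤ defect μ.1 := fun g h => by
    rw [abs_sub_comm]
    exact hβD h g
  -- The error of additivity in the second argument is bounded uniformly in the first, so it
  -- vanishes in the limit along `g ^ n`.
  have hright : ∀ g h k, β (h * k) g = β h g + β k g := by
    intro g h k
    have h0 : Tendsto (fun n : ℕ => (μ.1 (comm (g ^ n) (h * k)) - μ.1 (comm (g ^ n) h) -
        μ.1 (comm (g ^ n) k)) / n) atTop (𝓝 0) :=
      tendsto_div_natCast_of_abs_sub_le (C := defect μ.1) fun n _ => by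
        simpa using abs_comm_mul_right_le μ (g ^ n) h k
    have h1 := ((hβlim (h * k) g).sub (hβlim h g)).sub (hβlim k g)
    simp only [← sub_div] at h1
    linarith [tendsto_nhds_unique h0 h1]
  have hpow : ∀ g h (n : ℕ), β (h ^ n) g = n * β h g := by
    intro g h n
    have h1 : β 1 g = 0 := by simpa using hright g 1 1
    induction n with
    | zero => simpa using h1
    | succ n ih =>
      rw [pow_succ, hright, ih]
      push_cast
      ring
  -- Both `β h (g ^ n)` and `-β (g ^ n) h` approximate `μ([gⁿ,h])`, while each of `β h g` and `β g
  -- h` is multiplied by `n`.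
  have hanti : ∀ g h, β h g = -β g h := by
    intro g h
    refine eq_neg_of_add_eq_zero_left
      (eq_zero_of_forall_nat_mul_abs_le (C := defect μ.1 + defect μ.1) fun n => ?_)
    rw [← Nat.abs_cast n, ← abs_mul, mul_add, ← (hβ h).map_pow, ← hpow]
    have h1 := abs_le.1 (happ (g ^ n) h)
    have h2 := abs_le.1 (happ h (g ^ n))
    rw [map_comm_swap] at h2
    rw [abs_le]
    constructor <;> linarith [h1.1, h1.2, h2.1, h2.2]
  refine ⟨fun g h => β h g, happ, fun g h k => ?_, hright, fun g => ?_⟩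
  · change β k (g * h) = β k g + β k h
    rw [hanti, hright, neg_add, ← hanti, ← hanti]
  · linarith [hanti g g]

/-- Biadditive functions on a group, vanishing on the diagonal, descend to the abelianization. -/
theorem exists_form_of_biadditive (b : G → G → ℝ) (hl : ∀ g h k, b (g * h) k = b g k + b h k)
    (hr : ∀ g h k, b g (h * k) = b g h + b g k) (h0 : ∀ g, b g g = 0) :
    ∃ B : A (Ab G), ∀ g h, B.1 (p g) (p h) = b g h := by
  have hl1 : ∀ k, b 1 k = 0 := fun k => by simpa using hl 1 1 k
  have hr1 : ∀ g, b g 1 = 0 := fun g => by simpa using hr g 1 1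
  let R : G → Ab G →+ ℝ := fun g => MonoidHom.toAdditiveLeft
    (Abelianization.lift (A := Multiplicative ℝ)
      { toFun := fun h => Multiplicative.ofAdd (b g h)
        map_one' := by rw [hr1]; rfl
        map_mul' := fun h k => by rw [hr]; rfl })
  have hR : ∀ g h, R g (p h) = b g h := fun g h => rfl
  have hRext : ∀ u v : Ab G →+ ℝ, (∀ h, u (p h) = v (p h)) → u = v := by
    intro u v huv
    refine AddMonoidHom.ext fun γ => ?_
    obtain ⟨h, rfl⟩ := p_surjective γ
    exact huv h
  let L : Ab G →+ Ab G →+ ℝ := MonoidHom.toAdditiveLeft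
    (Abelianization.lift (A := Multiplicative (Ab G →+ ℝ))
      { toFun := fun g => Multiplicative.ofAdd (R g)
        map_one' := by
          refine congrArg Multiplicative.ofAdd (hRext _ 0 fun h => ?_)
          rw [hR, hl1]; rfl
        map_mul' := fun g k => by
          refine congrArg Multiplicative.ofAdd (hRext _ (R g + R k) fun h => ?_)
          rw [AddMonoidHom.add_apply, hR, hR, hR, hl] })
  have hL : ∀ g h, L (p g) (p h) = b g h := fun g h => rfl
  refine ⟨⟨LinearMap.mk₂ ℤ (fun γ δ => L γ δ) (by simp) (by simp) (by simp) (by simp), ?_⟩, hL⟩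
  intro γ
  obtain ⟨g, rfl⟩ := p_surjective γ
  exact (hL g g).trans (h0 g)

/-- The alternating form approximating an invariant quasimorphism on commutators. -/
theorem exists_form (μ : QInv (commutator G)) :
    ∃ B : A (Ab G), ∀ g h, |μ.1 (comm g h) - B.1 (p g) (p h)| ≤ defect μ.1 := by
  obtain ⟨b, hb, hl, hr, h0⟩ := exists_additive_approximation μ
  obtain ⟨B, hB⟩ := exists_form_of_biadditive b hl hr h0
  exact ⟨B, fun g h => by rw [hB]; exact hb g h⟩

/-- The two constants are unrelated, so any bounded approximation identifies the form: the sum or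
multiple of known forms for linearity, the zero form for restrictions. -/
theorem eq_of_abs_comm_sub_le (μ : QInv (commutator G)) {b b' : A (Ab G)} {C C' : ℝ}
    (h : ∀ g₁ g₂ : G, |μ.1 (comm g₁ g₂) - b.1 (p g₁) (p g₂)| ≤ C)
    (h' : ∀ g₁ g₂ : G, |μ.1 (comm g₁ g₂) - b'.1 (p g₁) (p g₂)| ≤ C') : b = b' := by
  refine bilinear_eq_of_abs_sub_le (C := C + C') fun g₁ g₂ => ?_
  have h1 := abs_le.1 (h g₁ g₂)
  have h2 := abs_le.1 (h' g₁ g₂)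
  rw [abs_le]
  constructor <;> linarith [h1.1, h1.2, h2.1, h2.2]

/-- The linear map sending an invariant quasimorphism to its alternating form. -/
theorem exists_linear_form : ∃ B : QInv (commutator G) →ₗ[ℝ] A (Ab G),
    ∀ (μ : QInv (commutator G)) (g₁ g₂ : G),
      |μ.1 (comm g₁ g₂) - (B μ).1 (p g₁) (p g₂)| ≤ defect μ.1 := by
  choose B hB using exists_form (G := G)
  refine ⟨{ toFun := B, map_add' := fun μ ν => ?_, map_smul' := fun c μ => ?_ }, hB⟩
  · refine eq_of_abs_comm_sub_le _ (hB (μ + ν)) (C' := defect μ.1 + defect ν.1) fun g₁ g₂ => ?_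
    have e : (μ + ν).1 (comm g₁ g₂) - (B μ + B ν).1 (p g₁) (p g₂) =
        (μ.1 (comm g₁ g₂) - (B μ).1 (p g₁) (p g₂)) +
          (ν.1 (comm g₁ g₂) - (B ν).1 (p g₁) (p g₂)) := by
      change μ.1 (comm g₁ g₂) + ν.1 (comm g₁ g₂) -
        ((B μ).1 (p g₁) (p g₂) + (B ν).1 (p g₁) (p g₂)) = _
      ring
    rw [e]
    exact (abs_add_le _ _).trans (add_le_add (hB μ g₁ g₂) (hB ν g₁ g₂))
  · refine eq_of_abs_comm_sub_le _ (hB (c • μ)) (C' := |c| * defect μ.1) fun g₁ g₂ => ?_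
    have e : (c • μ).1 (comm g₁ g₂) - (c • B μ).1 (p g₁) (p g₂) =
        c * (μ.1 (comm g₁ g₂) - (B μ).1 (p g₁) (p g₂)) := by
      change c * μ.1 (comm g₁ g₂) - c * (B μ).1 (p g₁) (p g₂) = _
      ring
    rw [RingHom.id_apply, e, abs_mul]
    exact mul_le_mul_of_nonneg_left (hB μ g₁ g₂) (abs_nonneg c)

/-- Restrictions of homogeneous quasimorphisms are bounded on commutators. -/
theorem abs_restrict_comm_le (φ : Q G) (g₁ g₂ : G) :
    |(restrict (commutator G) φ).1 (comm g₁ g₂)| ≤ defect φ.1 := by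
  have h := abs_le_defect φ.2.1 (g₁ * g₂ * g₁⁻¹) g₂⁻¹
  rw [Q_conj φ.2, IsHomogeneous.map_inv φ.2.2] at h
  have e : (restrict (commutator G) φ).1 (comm g₁ g₂) = φ.1 (g₁ * g₂ * g₁⁻¹ * g₂⁻¹) := rfl
  rw [e]
  simpa using h

theorem ker_eq_extendable (B : QInv (commutator G) →ₗ[ℝ] A (Ab G))
    (hB : ∀ (μ : QInv (commutator G)) (g₁ g₂ : G),
      |μ.1 (comm g₁ g₂) - (B μ).1 (p g₁) (p g₂)| ≤ defect μ.1) :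
    LinearMap.ker B = extendable (commutator G) := by
  refine le_antisymm (fun μ hμ => mem_extendable_of_abs_comm_le μ fun x y => ?_) ?_
  · have h := hB μ x y
    rw [LinearMap.mem_ker.1 hμ] at h
    simpa using h
  · rintro _ ⟨φ, rfl⟩
    refine LinearMap.mem_ker.2 (eq_of_abs_comm_sub_le _ (hB _) (C' := defect φ.1) fun g₁ g₂ => ?_)
    simpa using abs_restrict_comm_le φ g₁ g₂

/-- By bilinearity the form at `s k` is exactly `k` times its value at `γ`, so the error after
division is at most `C / k`. -/
theorem tendsto_comm_div (μ : QInv (commutator G)) {b : A (Ab G)} {C : ℝ}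
    (hb : ∀ g₁ g₂ : G, |μ.1 (comm g₁ g₂) - b.1 (p g₁) (p g₂)| ≤ C) (γ : Ab G) (s : ℕ → G)
    (hs : ∀ k : ℕ, 1 ≤ k → p (s k) = k • γ) (g : G) :
    Tendsto (fun k : ℕ => μ.1 (comm (s k) g) / (k : ℝ)) atTop (𝓝 (b.1 γ (p g))) ∧
      Tendsto (fun k : ℕ => μ.1 (comm g (s k)) / (k : ℝ)) atTop (𝓝 (b.1 (p g) γ)) := by
  constructor <;> refine tendsto_div_natCast_of_abs_sub_le (C := C) fun k hk => ?_
  · simpa [hs k hk] using hb (s k) g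
  · simpa [hs k hk] using hb g (s k)

end BilinearForm

end InvQM

end

theorem mainTheorem5 {G : Type*} [Group G] :
    ∃ B : InvQM.QInv (commutator G) →ₗ[ℝ] InvQM.A (InvQM.Ab G),
      -- `b_μ = B μ` approximates `μ` on commutators up to the defect
      (∀ (μ : InvQM.QInv (commutator G)) (g₁ g₂ : G),
        |μ.1 (InvQM.comm g₁ g₂) - (B μ).1 (InvQM.p g₁) (InvQM.p g₂)| ≤ InvQM.defect μ.1) ∧
      -- and is the only alternating form that does
      (∀ (μ : InvQM.QInv (commutator G)) (b : InvQM.A (InvQM.Ab G)),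
        (∀ g₁ g₂ : G,
          |μ.1 (InvQM.comm g₁ g₂) - b.1 (InvQM.p g₁) (InvQM.p g₂)| ≤ InvQM.defect μ.1) →
        b = B μ) ∧
      -- limit formula
      (∀ (μ : InvQM.QInv (commutator G)) (g₁ g₂ : G),
        Filter.Tendsto (fun k : ℕ => μ.1 (InvQM.comm (g₁ ^ k) g₂) / (k : ℝ)) Filter.atTop
          (nhds ((B μ).1 (InvQM.p g₁) (InvQM.p g₂))) ∧
        Filter.Tendsto (fun l : ℕ => μ.1 (InvQM.comm g₁ (g₂ ^ l)) / (l : ℝ)) Filter.atTop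
          (nhds ((B μ).1 (InvQM.p g₁) (InvQM.p g₂)))) ∧
      -- refined limit formula
      (∀ (μ : InvQM.QInv (commutator G)) (γ : InvQM.Ab G) (s : ℕ → G),
        (∀ k : ℕ, 1 ≤ k → InvQM.p (s k) = k • γ) →
        ∀ g : G,
          Filter.Tendsto (fun k : ℕ => μ.1 (InvQM.comm (s k) g) / (k : ℝ)) Filter.atTop
            (nhds ((B μ).1 γ (InvQM.p g))) ∧
          Filter.Tendsto (fun k : ℕ => μ.1 (InvQM.comm g (s k)) / (k : ℝ)) Filter.atTop
            (nhds ((B μ).1 (InvQM.p g) γ))) ∧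
      -- the kernel consists exactly of the extendable quasimorphisms
      LinearMap.ker B = InvQM.extendable (commutator G) ∧
      -- the induced injection `V(G,N) ↪ A(Γ)`
      ∃ Bbar : InvQM.V (commutator G) →ₗ[ℝ] InvQM.A (InvQM.Ab G),
        (∀ μ : InvQM.QInv (commutator G), Bbar (Submodule.Quotient.mk μ) = B μ) ∧
        Function.Injective Bbar := by
  obtain ⟨B, hB⟩ := InvQM.exists_linear_form (G := G)
  have hker := InvQM.ker_eq_extendable B hB
  refine ⟨B, hB, fun μ b hb => InvQM.eq_of_abs_comm_sub_le μ hb (hB μ), fun μ g₁ g₂ => ⟨?_, ?_⟩,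
    fun μ γ s hs g => InvQM.tendsto_comm_div μ (hB μ) γ s hs g, hker,
    (InvQM.extendable (commutator G)).liftQ B hker.ge, fun μ => rfl, ?_⟩
  · exact (InvQM.tendsto_comm_div μ (hB μ) _ _ (fun k _ => InvQM.p_pow g₁ k) g₂).1
  · exact (InvQM.tendsto_comm_div μ (hB μ) _ _ (fun k _ => InvQM.p_pow g₂ k) g₁).2
  · rw [← LinearMap.ker_eq_bot]
    exact Submodule.ker_liftQ_eq_bot _ _ _ hker.le
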